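/- Let $L \ge 2$, let $\kappa = (\kappa_1,\dots,\kappa_L)$ be positive integers, $N = \kappa_1 + \dots + \kappa_L$, and let $x_1,\dots,x_L$ be distinct real numbers, $\mathcal X=\{x_1,\dots,x_L\}$. Let $$\Omega_\kappa = \Big\{\omega \in \mathcal X^N : \#\{i : \omega_i = x_\ell\} = \kappa_\ell \text{ for } \ell = 1,\dots,L\Big\}$$ be the multislice with its uniform distribution $\mathbb P_\kappa$. For $1 \le n \le N$ let $pr_n$ be the projection onto the first $n$ coordinates, $\Omega_{\kappa,n} = pr_n(\Omega_\kappa)$, and let $\mathbb P_{\kappa,n}$ be the push-forward of $\mathbb P_\kappa$ under $pr_n$, i.e. the law of $n$ out of $N$ sampling without replacement. For $\omega \in \Omega_{\kappa,n}$ and nonempty $A \subseteq \Omega_{\kappa,n}$ let $$d_T(\omega, A) = \sup_{\alpha \in \mathbb R^n,\ |\alpha| = 1}\ \inf_{\omega' \in A}\ \sum_{i=1}^n |\alpha_i|\, \mathbf 1_{\{\omega_i \ne \omega'_i\}}$$ be the convex distance, where $|\alpha|$ is the Euclidean norm. Call $A$ symmetric if it is stable under all permutations of the $n$ coordinates. **Theorem.**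 For any symmetric set $A \subseteq \Omega_{\kappa,n}$ with $\mathbb P_{\kappa,n}(A) \ge \frac12$ and any $t \ge 0$, $$\mathbb P_{\kappa,n}\big(d_T(\cdot, A) \ge t\big) \le e \exp\Big(-\frac{t^2}{16\,(1 - \frac nN)}\Big),$$ where for $n = N$ and $t > 0$ the right-hand side is read as $0$ (for $n=N$ and $t=0$ nothing is claimed). -/

import Mathlib

/-- The multislice of a population of size `N` in which the value `x l` occurs exactly `κ l` times:
all arrangements `ω = (ω₁, …, ω_N)` of the population. -/
def multislice {L N : ℕ} (κ : Fin L → ℕ) (x : Fin L → ℝ) : Set (Fin N → ℝ) :=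
  {ω | (∀ i, ω i ∈ Set.range x) ∧ ∀ l, (Finset.univ.filter fun i => ω i = x l).card = κ l}

/-- The projection of a vector of length `N` onto its first `n` coordinates. -/
def firstCoords {n N : ℕ} (h : n ≤ N) (ω : Fin N → ℝ) : Fin n → ℝ :=
  fun i => ω (Fin.castLE h i)

/-- The possible samples of size `n`, i.e. the projection of the multislice onto the first `n`
coordinates. -/
def sampleSpace {L n N : ℕ} (κ : Fin L → ℕ) (x : Fin L → ℝ) (h : n ≤ N) : Set (Fin n → ℝ) :=
  firstCoords h '' multislice κ x

/-- The law of an ordered sample of size `n` drawn without replacement from the population of size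
`N`: the push-forward of the uniform distribution on the multislice under the projection onto the
first `n` coordinates. -/
noncomputable def sampleLaw {L n N : ℕ} (κ : Fin L → ℕ) (x : Fin L → ℝ) (h : n ≤ N) :
    MeasureTheory.Measure (Fin n → ℝ) :=
  (ProbabilityTheory.uniformOn (multislice (N := N) κ x)).map (firstCoords h)

/-- A set of vectors is symmetric if it is stable under all permutations of the coordinates. -/
def IsSymmetricSet {n : ℕ} (A : Set (Fin n → ℝ)) : Prop :=
  ∀ σ : Equiv.Perm (Fin n), ∀ ω ∈ A, (fun i => ω (σ i)) ∈ A

/-- The weighted Hamming distance `d_α(ω, ω') = ∑ |α_i| 1{ω_i ≠ ω'_i}`. -/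
noncomputable def weightedHamming {n : ℕ} (α : EuclideanSpace ℝ (Fin n)) (ω ω' : Fin n → ℝ) : ℝ :=
  ∑ i, if ω i ≠ ω' i then |α i| else 0

/-- Talagrand's convex distance `d_T(ω, A) = sup_{|α| = 1} inf_{ω' ∈ A} d_α(ω, ω')`, where `|α|` is
the Euclidean norm. (For `n ≥ 1` and `A` nonempty, the supremum and the infimum are over nonempty
bounded families.) -/
noncomputable def convexDistance {n : ℕ} (ω : Fin n → ℝ) (A : Set (Fin n → ℝ)) : ℝ :=
  ⨆ α : Metric.sphere (0 : EuclideanSpace ℝ (Fin n)) 1, ⨅ ω' : A, weightedHamming α.1 ω ω'.1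

/-! ### Entropy and the modified logarithmic Sobolev inequality on the symmetric group. -/

section EntropyOnPermutations

open scoped BigOperators
open Finset (expect_le_expect expect_add_distrib expect_sub_distrib mul_expect expect_mul)

/-! Fix an arrangement `ω` of the population. A uniform permutation `σ` makes `ω ∘ σ` uniform on the
multislice, so the claim is a tail bound for f(σ), the convex distance to `A` of the first `n`
coordinates of `ω ∘ σ`.

Random transpositions satisfy a modified logarithmic Sobolev inequality (`uniformEntropy_perm_le`).
Applied to exp(s f), it bounds the entropy by the squared decreases of f along transpositions. Since
`A` is symmetric, f ignores the order within the sample, so only exchanges between a sampled and an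
unsampled position count. Such an exchange at the sampled position i lowers f by at most |α_i|, with
α a maximising unit vector. As ∑ α_i² = 1 and each i has N - n partners, the sum over ordered pairs
is at most 2(N - n) (`sum_sq_gradient_convexDistance_le`). Dividing by N gives the entropy constant
c = 2(1 - n/N).

Herbst's argument turns this into the tail exp(-(t - m)²/(4c)) above the mean m. Since f vanishes
with probability at least 1/2, m ≤ 2√c (`cosh_le_exp_of_expect_exp_le`). Recentring at 0 replaces 4c
by 8c = 16(1 - n/N) and costs the factor e (`expect_tail_le`). -/

/-- The entropy `𝔼 g log g - 𝔼 g log 𝔼 g` with respect to the uniform distribution. -/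
noncomputable def uniformEntropy {Ω : Type*} [Fintype Ω] (g : Ω → ℝ) : ℝ :=
  (𝔼 ω, g ω * Real.log (g ω)) - (𝔼 ω, g ω) * Real.log (𝔼 ω, g ω)

/-- The integrand `(x - y)(log x - log y)` of the modified logarithmic Dirichlet form. -/
noncomputable def logDirichlet (x y : ℝ) : ℝ := (x - y) * (Real.log x - Real.log y)

theorem logDirichlet_self (x : ℝ) : logDirichlet x x = 0 := by simp [logDirichlet]

theorem univ_expect_pos {Ω : Type*} [Fintype Ω] [Nonempty Ω] {g : Ω → ℝ} (hg : ∀ ω, 0 < g ω) :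
    0 < 𝔼 ω, g ω :=
  Finset.expect_pos (fun ω _ => hg ω) Finset.univ_nonempty

theorem expect_comp_equiv {Ω Ω' : Type*} [Fintype Ω] [Fintype Ω'] (e : Ω ≃ Ω') (g : Ω' → ℝ) :
    𝔼 ω, g (e ω) = 𝔼 ω', g ω' :=
  Fintype.expect_equiv e _ _ fun _ => rfl

theorem univ_expect_prod {α β : Type*} [Fintype α] [Fintype β] (g : α × β → ℝ) :
    𝔼 p, g p = 𝔼 a, 𝔼 b, g (a, b) := by
  rw [← Finset.univ_product_univ, Finset.expect_product]

theorem uniformEntropy_comp_equiv {Ω Ω' : Type*} [Fintype Ω] [Fintype Ω'] (e : Ω ≃ Ω')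
    (g : Ω' → ℝ) : uniformEntropy (fun ω => g (e ω)) = uniformEntropy g := by
  unfold uniformEntropy
  rw [expect_comp_equiv e g, expect_comp_equiv e fun ω => g ω * Real.log (g ω)]

/-- Chain rule for the entropy on a product. -/
theorem uniformEntropy_prod {α β : Type*} [Fintype α] [Fintype β] (g : α × β → ℝ) :
    uniformEntropy g =
      (𝔼 a, uniformEntropy fun b => g (a, b)) + uniformEntropy fun a => 𝔼 b, g (a, b) := by
  simp only [uniformEntropy, univ_expect_prod, expect_sub_distrib]
  ring

/-- By Jensen, log 𝔼 h ≥ 𝔼 log h, so the entropy is at most the covariance of h and log h, which is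
half the double average on the right. -/
theorem uniformEntropy_le_logDirichlet {α : Type*} [Fintype α] [Nonempty α] {h : α → ℝ}
    (hh : ∀ a, 0 < h a) : uniformEntropy h ≤ (1 / 2) * 𝔼 a, 𝔼 b, logDirichlet (h a) (h b) := by
  have hm := univ_expect_pos hh
  set m := 𝔼 a, h a with hmdef
  have jensen : 𝔼 a, Real.log (h a) ≤ Real.log m := by
    have h1 : 𝔼 a, Real.log (h a) ≤ 𝔼 a, (h a / m - 1 + Real.log m) := by
      refine expect_le_expect fun a _ => ?_
      have := Real.log_le_sub_one_of_pos (div_pos (hh a) hm)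
      rw [Real.log_div (hh a).ne' hm.ne'] at this
      linarith
    rw [expect_add_distrib, expect_sub_distrib, ← Finset.expect_div, ← hmdef,
      Fintype.expect_const, Fintype.expect_const, div_self hm.ne'] at h1
    linarith
  have expand : 𝔼 a, 𝔼 b, logDirichlet (h a) (h b) =
      2 * ((𝔼 a, h a * Real.log (h a)) - m * 𝔼 a, Real.log (h a)) := by
    have : ∀ a b, logDirichlet (h a) (h b) = h a * Real.log (h a) + h b * Real.log (h b)
        - h a * Real.log (h b) - h b * Real.log (h a) := fun a b => by
      unfold logDirichlet; ring
    simp only [this, expect_add_distrib, expect_sub_distrib, Fintype.expect_const,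
      ← mul_expect, ← expect_mul, ← hmdef]
    ring
  rw [expand, uniformEntropy, ← hmdef]
  nlinarith

/-- Joint convexity of `logDirichlet`. -/
theorem logDirichlet_expect_le {Ω : Type*} [Fintype Ω] [Nonempty Ω] {u v : Ω → ℝ}
    (hu : ∀ ω, 0 < u ω) (hv : ∀ ω, 0 < v ω) :
    logDirichlet (𝔼 ω, u ω) (𝔼 ω, v ω) ≤ 𝔼 ω, logDirichlet (u ω) (v ω) := by
  have hU := univ_expect_pos hu
  have hV := univ_expect_pos hv
  set U := 𝔼 ω, u ω with hUdef
  set V := 𝔼 ω, v ω with hVdef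
  -- The tangent plane at (A, B) lies below the jointly convex function a log(a/b).
  have key : ∀ a b A B : ℝ, 0 < a → 0 < b → 0 < A → 0 < B →
      a * (Real.log A - Real.log B) + a - b * (A / B) ≤ a * (Real.log a - Real.log b) := by
    intro a b A B ha hb hA hB
    have h1 := Real.log_le_sub_one_of_pos (div_pos (mul_pos hb hA) (mul_pos ha hB))
    rw [Real.log_div (mul_pos hb hA).ne' (mul_pos ha hB).ne', Real.log_mul hb.ne' hA.ne',
      Real.log_mul ha.ne' hB.ne'] at h1
    have h2 := mul_le_mul_of_nonneg_left h1 ha.le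
    have h3 : a * (b * A / (a * B) - 1) = b * (A / B) - a := by field_simp
    linarith
  have h1 : 𝔼 ω, ((u ω * (Real.log U - Real.log V) + u ω - v ω * (U / V)) +
      (v ω * (Real.log V - Real.log U) + v ω - u ω * (V / U))) ≤
      𝔼 ω, logDirichlet (u ω) (v ω) := by
    refine expect_le_expect fun ω _ => ?_
    have h1 := key _ _ U V (hu ω) (hv ω) hU hV
    have h2 := key _ _ V U (hv ω) (hu ω) hV hU
    have h3 : logDirichlet (u ω) (v ω) = u ω * (Real.log (u ω) - Real.log (v ω)) +
      v ω * (Real.log (v ω) - Real.log (u ω)) := by unfold logDirichlet; ring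
    linarith
  simp only [expect_add_distrib, expect_sub_distrib, ← expect_mul, ← hUdef, ← hVdef,
    mul_div_cancel₀ _ hU.ne', mul_div_cancel₀ _ hV.ne'] at h1
  refine le_trans (le_of_eq ?_) h1
  unfold logDirichlet
  ring

/-- The contribution of the transposition `(i j)` to the Dirichlet form of `g`. -/
noncomputable def swapForm {n : ℕ} (g : Equiv.Perm (Fin n) → ℝ) (i j : Fin n) : ℝ :=
  𝔼 σ, logDirichlet (g σ) (g (σ * Equiv.swap i j))

theorem swapForm_self {n : ℕ} (g : Equiv.Perm (Fin n) → ℝ) (i : Fin n) : swapForm g i i = 0 :=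
  Finset.expect_eq_zero fun σ _ => by rw [Equiv.swap_self, ← Equiv.Perm.one_def, mul_one,
    logDirichlet_self]

/-- Right multiplication by the involution `s` preserves the uniform law and conjugates
transpositions. This lets the induction below single out any point instead of 0. -/
theorem swapForm_mul_swap {n : ℕ} (g : Equiv.Perm (Fin n) → ℝ) (s : Equiv.Perm (Fin n))
    (hs : s * s = 1) (j k : Fin n) :
    swapForm (fun σ => g (σ * s)) j k = swapForm g (s j) (s k) := by
  unfold swapForm
  rw [← expect_comp_equiv (Equiv.mulRight s)
    fun σ => logDirichlet (g σ) (g (σ * Equiv.swap (s j) (s k)))]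
  refine Finset.expect_congr rfl fun σ _ => ?_
  have hinv : s⁻¹ = s := inv_eq_of_mul_eq_one_left hs
  have : Equiv.swap (s j) (s k) = s * Equiv.swap j k * s := by
    have := Equiv.swap_apply_apply s j k
    rw [hinv] at this
    exact this
  simp only [Equiv.coe_mulRight, this]
  congr 2
  simp only [← mul_assoc, mul_assoc σ s s, hs, mul_one]

theorem sum_decomposeFin {n : ℕ} (F : Equiv.Perm (Fin (n + 1)) → ℝ) (a : Fin (n + 1)) :
    ∑ e : Equiv.Perm (Fin n), F (Equiv.Perm.decomposeFin.symm (a, e)) =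
      ∑ σ, if σ 0 = a then F σ else 0 := by
  rw [← Equiv.sum_comp Equiv.Perm.decomposeFin.symm, Fintype.sum_prod_type]
  simp

/-- On a fibre where the image of 0 is fixed, transpositions of the smaller group act as the
transpositions that leave position 0 alone. -/
theorem decomposeFin_symm_mul_swap {n : ℕ} (a : Fin (n + 1)) (e : Equiv.Perm (Fin n))
    (j k : Fin n) : Equiv.Perm.decomposeFin.symm (a, e * Equiv.swap j k) =
      Equiv.Perm.decomposeFin.symm (a, e) * Equiv.swap j.succ k.succ := by
  ext x
  refine Fin.cases ?_ (fun y => ?_) x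
  · rw [Equiv.Perm.mul_apply, Equiv.swap_apply_of_ne_of_ne (Fin.succ_ne_zero j).symm
      (Fin.succ_ne_zero k).symm]
    simp
  · rw [Equiv.Perm.mul_apply, ← (Fin.succ_injective n).map_swap]
    simp

/-- The entropy of the image of the first point is controlled by the transpositions moving it. -/
theorem uniformEntropy_decomposeFin_le {n : ℕ} {g : Equiv.Perm (Fin (n + 1)) → ℝ}
    (hg : ∀ σ, 0 < g σ) :
    (uniformEntropy fun a => 𝔼 e, g (Equiv.Perm.decomposeFin.symm (a, e))) ≤
      1 / (2 * ((n : ℝ) + 1)) * ∑ j, swapForm g 0 j := by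
  have hpos : ∀ a, 0 < 𝔼 e, g (Equiv.Perm.decomposeFin.symm (a, e)) :=
    fun a => univ_expect_pos fun e => hg _
  -- Left multiplication by (a b) carries the fibre σ 0 = a onto the fibre σ 0 = b. Both averages
  -- then run over the same `e`, as joint convexity requires.
  have hshift : ∀ a b, 𝔼 e, g (Equiv.Perm.decomposeFin.symm (b, e)) =
      𝔼 e, g (Equiv.swap a b * Equiv.Perm.decomposeFin.symm (a, e)) := by
    intro a b
    rw [Fintype.expect_eq_sum_div_card, Fintype.expect_eq_sum_div_card, sum_decomposeFin g b,
      sum_decomposeFin (fun σ => g (Equiv.swap a b * σ)) a,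
      ← Equiv.sum_comp (Equiv.mulLeft (Equiv.swap a b))]
    congr 1
    refine Finset.sum_congr rfl fun σ _ => ?_
    have : Equiv.swap a b (σ 0) = b ↔ σ 0 = a := by
      rw [← Equiv.eq_symm_apply]; simp
    simp [this]
  refine (uniformEntropy_le_logDirichlet hpos).trans ?_
  have h1 : 𝔼 a, 𝔼 b, logDirichlet (𝔼 e, g (Equiv.Perm.decomposeFin.symm (a, e)))
      (𝔼 e, g (Equiv.Perm.decomposeFin.symm (b, e))) ≤
      𝔼 a, 𝔼 b, 𝔼 e, logDirichlet (g (Equiv.Perm.decomposeFin.symm (a, e)))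
        (g (Equiv.swap (Equiv.Perm.decomposeFin.symm (a, e) 0) b *
          Equiv.Perm.decomposeFin.symm (a, e))) := by
    refine expect_le_expect fun a _ => expect_le_expect fun b _ => ?_
    rw [hshift a b]
    simp only [Equiv.Perm.decomposeFin_symm_apply_zero]
    exact logDirichlet_expect_le (fun _ => hg _) fun _ => hg _
  have h2 : 𝔼 a, 𝔼 b, 𝔼 e, logDirichlet (g (Equiv.Perm.decomposeFin.symm (a, e)))
        (g (Equiv.swap (Equiv.Perm.decomposeFin.symm (a, e) 0) b *
          Equiv.Perm.decomposeFin.symm (a, e))) =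
      1 / ((n : ℝ) + 1) * ∑ j, swapForm g 0 j := by
    rw [Finset.expect_congr rfl fun a _ => Finset.expect_comm _ _ _,
      ← univ_expect_prod fun p => 𝔼 b, logDirichlet (g (Equiv.Perm.decomposeFin.symm p))
        (g (Equiv.swap (Equiv.Perm.decomposeFin.symm p 0) b * Equiv.Perm.decomposeFin.symm p)),
      expect_comp_equiv Equiv.Perm.decomposeFin.symm
        fun σ => 𝔼 b, logDirichlet (g σ) (g (Equiv.swap (σ 0) b * σ))]
    unfold swapForm
    rw [← Finset.expect_sum_comm, mul_expect]
    refine Finset.expect_congr rfl fun σ _ => ?_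
    rw [Fintype.expect_eq_sum_div_card, ← Equiv.sum_comp σ, Fintype.card_fin]
    -- Exchanging the values σ 0 and σ j is the same as exchanging the positions 0 and j.
    have : ∀ j, Equiv.swap (σ 0) (σ j) * σ = σ * Equiv.swap 0 j := fun j =>
      (Equiv.mul_swap_eq_swap_mul σ 0 j).symm
    simp only [this]
    push_cast
    ring
  calc _ ≤ 1 / 2 * (1 / ((n : ℝ) + 1) * ∑ j, swapForm g 0 j) := by
        rw [← h2]; exact mul_le_mul_of_nonneg_left h1 (by norm_num)
    _ = _ := by
        have : (n : ℝ) + 1 ≠ 0 := by positivity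
        field_simp

theorem logDirichlet_nonneg {x y : ℝ} (hx : 0 < x) (hy : 0 < y) : 0 ≤ logDirichlet x y := by
  unfold logDirichlet
  rcases le_total x y with h | h
  · exact mul_nonneg_of_nonpos_of_nonpos (by linarith) (by linarith [Real.log_le_log hx h])
  · exact mul_nonneg (by linarith) (by linarith [Real.log_le_log hy h])

/-- The modified logarithmic Sobolev inequality for random transpositions. -/
theorem uniformEntropy_perm_le {n : ℕ} {g : Equiv.Perm (Fin n) → ℝ} (hg : ∀ σ, 0 < g σ) :
    uniformEntropy g ≤ 1 / (2 * (n : ℝ)) * ∑ i, ∑ j, swapForm g i j := by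
  induction n with
  | zero => simp [uniformEntropy]
  | succ n ih =>
    -- Chain rule for σ as the pair (σ 0, rest): induction inside each fibre, the preceding bound
    -- for the law of σ 0.
    have step : ∀ f : Equiv.Perm (Fin (n + 1)) → ℝ, (∀ σ, 0 < f σ) → uniformEntropy f ≤
        1 / (2 * (n : ℝ)) * ∑ j : Fin n, ∑ k : Fin n, swapForm f j.succ k.succ +
          1 / (2 * ((n : ℝ) + 1)) * ∑ j, swapForm f 0 j := by
      intro f hf
      rw [← uniformEntropy_comp_equiv Equiv.Perm.decomposeFin.symm, uniformEntropy_prod]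
      refine add_le_add ?_ (uniformEntropy_decomposeFin_le hf)
      calc _ ≤ 𝔼 a, 1 / (2 * (n : ℝ)) * ∑ j, ∑ k,
            swapForm (fun e => f (Equiv.Perm.decomposeFin.symm (a, e))) j k :=
            expect_le_expect fun a _ => ih fun e => hf _
        _ = _ := by
          rw [← mul_expect, Finset.expect_sum_comm]
          congr 1
          refine Finset.sum_congr rfl fun j _ => ?_
          rw [Finset.expect_sum_comm]
          refine Finset.sum_congr rfl fun k _ => ?_
          unfold swapForm
          simp only [decomposeFin_symm_mul_swap]
          rw [← univ_expect_prod fun p => logDirichlet (f (Equiv.Perm.decomposeFin.symm p))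
              (f (Equiv.Perm.decomposeFin.symm p * Equiv.swap j.succ k.succ)),
            expect_comp_equiv Equiv.Perm.decomposeFin.symm
              fun σ => logDirichlet (f σ) (f (σ * Equiv.swap j.succ k.succ))]
    set S := ∑ i, ∑ j, swapForm g i j with hS
    have hSnn : 0 ≤ S := Finset.sum_nonneg fun i _ => Finset.sum_nonneg fun j _ =>
      Finset.expect_nonneg fun σ _ => logDirichlet_nonneg (hg _) (hg _)
    -- `step` with i in the role of 0. Removing both row i and column i from S is exact because the
    -- diagonal term vanishes.
    have average : ∀ i, uniformEntropy g ≤ 1 / (2 * (n : ℝ)) *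
        (S - (∑ j, swapForm g i j) - ∑ j, swapForm g j i) +
          1 / (2 * ((n : ℝ) + 1)) * ∑ j, swapForm g i j := by
      intro i
      set s := Equiv.swap 0 i with hs
      have hss : s * s = 1 := Equiv.swap_mul_self _ _
      have h1 := step (fun σ => g (σ * s)) fun σ => hg _
      have h2 : uniformEntropy (fun σ => g (σ * s)) = uniformEntropy g :=
        uniformEntropy_comp_equiv (Equiv.mulRight s) g
      simp only [h2, swapForm_mul_swap g s hss] at h1
      have hs0 : s 0 = i := Equiv.swap_apply_left _ _
      have h3 : ∑ j, swapForm g (s 0) (s j) = ∑ j, swapForm g i j := by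
        rw [hs0, Equiv.sum_comp s]
      have h4 : ∑ j : Fin n, ∑ k : Fin n, swapForm g (s j.succ) (s k.succ) =
          S - (∑ j, swapForm g i j) - ∑ j, swapForm g j i := by
        have e1 : S = ∑ j, ∑ k, swapForm g (s j) (s k) := by
          rw [hS, ← Equiv.sum_comp s]
          exact Finset.sum_congr rfl fun j _ => (Equiv.sum_comp s _).symm
        have e2 : ∑ j, swapForm g j i = ∑ j, swapForm g (s j) (s 0) := by
          rw [hs0, Equiv.sum_comp s fun j => swapForm g j i]
        rw [e1, e2, ← h3, Fin.sum_univ_succ (n := n)]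
        simp only [Fin.sum_univ_succ, Finset.sum_add_distrib, swapForm_self]
        ring
      rw [h3, h4] at h1
      exact h1
    have total : ((n : ℝ) + 1) * uniformEntropy g ≤
        1 / (2 * (n : ℝ)) * (((n : ℝ) + 1) * S - S - S) + 1 / (2 * ((n : ℝ) + 1)) * S := by
      have h1 := Finset.sum_le_sum fun i (_ : i ∈ Finset.univ) => average i
      rw [Finset.sum_const, Finset.sum_add_distrib, ← Finset.mul_sum, ← Finset.mul_sum,
        Finset.sum_sub_distrib, Finset.sum_sub_distrib, Finset.sum_const, ← hS,
        Finset.sum_comm (f := fun i j => swapForm g j i), ← hS] at h1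
      simpa using h1
    have hn : 0 ≤ (n : ℝ) := Nat.cast_nonneg n
    -- For n > 0 the coefficient is (n - 1)/(2n) + 1/(2(n + 1)) = 1/2 - 1/(2n(n + 1)). For n = 0 the
    -- first term is 0 by the convention 1/0 = 0.
    have coef : 1 / (2 * (n : ℝ)) * (((n : ℝ) + 1) * S - S - S) + 1 / (2 * ((n : ℝ) + 1)) * S
        ≤ 1 / 2 * S := by
      rcases hn.eq_or_lt with h0 | h0
      · rw [← h0]; norm_num
      · have : 1 / (2 * (n : ℝ)) * (((n : ℝ) + 1) * S - S - S) + 1 / (2 * ((n : ℝ) + 1)) * S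
            = 1 / 2 * S - S / (2 * n * (n + 1)) := by field_simp; ring
        rw [this]
        have : 0 ≤ S / (2 * n * (n + 1)) := by positivity
        linarith
    push_cast
    rw [div_mul_eq_mul_div, le_div_iff₀ (by positivity)]
    linarith

end EntropyOnPermutations

/-! ### From entropy bounds to Gaussian tails. -/

section Concentration

open scoped BigOperators
open Finset (expect_le_expect expect_add_distrib expect_sub_distrib mul_expect expect_mul)

/-- Herbst's argument: an entropy bound of order `c s²` yields a sub-Gaussian Laplace transform. -/
theorem expect_exp_le_of_uniformEntropy_le {Ω : Type*} [Fintype Ω] [Nonempty Ω] {f : Ω → ℝ} {c : ℝ}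
    (hent : ∀ s : ℝ, 0 < s → uniformEntropy (fun ω => Real.exp (s * f ω)) ≤
      c * s ^ 2 * 𝔼 ω, Real.exp (s * f ω)) {s : ℝ} (hs : 0 < s) :
    𝔼 ω, Real.exp (s * f ω) ≤ Real.exp (s * (𝔼 ω, f ω) + c * s ^ 2) := by
  set Z : ℝ → ℝ := fun u => 𝔼 ω, Real.exp (u * f ω) with hZ
  have hZpos : ∀ u, 0 < Z u := fun u => univ_expect_pos fun ω => Real.exp_pos _
  have hZ' : ∀ u, HasDerivAt Z (𝔼 ω, f ω * Real.exp (u * f ω)) u := by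
    intro u
    simp only [hZ, Fintype.expect_eq_sum_div_card]
    refine HasDerivAt.div_const (HasDerivAt.fun_sum fun ω _ => ?_) _
    have := ((hasDerivAt_id u).mul_const (f ω)).exp
    simpa [mul_comm] using this
  have hZ0 : Z 0 = 1 := by simp [hZ]
  have hK' : ∀ u, HasDerivAt (fun u => Real.log (Z u))
      ((𝔼 ω, f ω * Real.exp (u * f ω)) / Z u) u := fun u => (hZ' u).log (hZpos u).ne'
  -- The entropy of exp(u f) is u Z' - Z log Z, which is u² Z times the derivative of log Z / u. The
  -- hypothesis therefore says exactly that ψ decreases, and its limit at 0+ is the mean of f.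
  set ψ : ℝ → ℝ := fun u => Real.log (Z u) / u - c * u with hψ
  have hψ' : ∀ u, 0 < u → HasDerivAt ψ
      (((𝔼 ω, f ω * Real.exp (u * f ω)) / Z u * u - Real.log (Z u) * 1) / u ^ 2 - c) u := by
    intro u hu
    have h2 : HasDerivAt (fun u : ℝ => c * u) c u := by
      simpa using (hasDerivAt_id u).const_mul c
    exact ((hK' u).div (hasDerivAt_id u) hu.ne').sub h2
  have hanti : AntitoneOn ψ (Set.Ioi 0) := by
    refine antitoneOn_of_deriv_nonpos (convex_Ioi 0)
      (fun u hu => (hψ' u hu).continuousAt.continuousWithinAt)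
      (fun u hu => (hψ' u (by simpa using hu)).differentiableAt.differentiableWithinAt) ?_
    intro u hu
    rw [interior_Ioi] at hu
    have hu : 0 < u := hu
    rw [(hψ' u hu).deriv]
    have h1 := hent u hu
    have h2 : uniformEntropy (fun ω => Real.exp (u * f ω)) =
        u * (𝔼 ω, f ω * Real.exp (u * f ω)) - Z u * Real.log (Z u) := by
      unfold uniformEntropy
      rw [mul_expect]
      congr 1
      refine Finset.expect_congr rfl fun ω _ => ?_
      rw [Real.log_exp]; ring
    rw [h2] at h1
    have hz := hZpos u
    rw [sub_nonpos, div_le_iff₀ (by positivity)]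
    have h3 : (𝔼 ω, f ω * Real.exp (u * f ω)) / Z u * u - Real.log (Z u) * 1 =
        (u * (𝔼 ω, f ω * Real.exp (u * f ω)) - Z u * Real.log (Z u)) / Z u := by
      rw [mul_one, sub_div, mul_div_cancel_left₀ _ hz.ne', div_mul_eq_mul_div, mul_comm u]
    rw [h3, div_le_iff₀ hz]
    exact h1
  have hlim : Filter.Tendsto ψ (nhdsWithin 0 (Set.Ioi 0)) (nhds (𝔼 ω, f ω)) := by
    have h1 := (hK' 0).tendsto_slope_zero_right
    have h2 : Filter.Tendsto (fun u : ℝ => c * u) (nhdsWithin 0 (Set.Ioi 0)) (nhds 0) := by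
      have : Filter.Tendsto (fun u : ℝ => c * u) (nhds 0) (nhds (c * 0)) :=
        (continuous_const.mul continuous_id).tendsto 0
      rw [mul_zero] at this
      exact this.mono_left nhdsWithin_le_nhds
    have h3 := h1.sub h2
    simp only [zero_add, hZ0, Real.log_one, sub_zero, zero_mul, Real.exp_zero, mul_one, div_one,
      smul_eq_mul] at h3
    refine h3.congr fun u => ?_
    simp only [hψ]
    ring
  have hle : ψ s ≤ 𝔼 ω, f ω := by
    refine ge_of_tendsto hlim ?_
    filter_upwards [Ioo_mem_nhdsGT hs] with u hu
    exact hanti hu.1 hs hu.2.le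
  have h1 : Real.log (Z s) ≤ s * (𝔼 ω, f ω) + c * s ^ 2 := by
    have : Real.log (Z s) / s ≤ (𝔼 ω, f ω) + c * s := by simp only [hψ] at hle; linarith
    rw [div_le_iff₀ hs] at this
    linarith
  exact (Real.log_le_iff_le_exp (hZpos s)).1 h1

/-- This controls the mean of f. The extremal case takes the values 0 and 2m with probability 1/2
each, m being the mean; there 𝔼 exp(s(f - m)) equals cosh(s m). -/
theorem cosh_le_exp_of_expect_exp_le {Ω : Type*} [Fintype Ω] [Nonempty Ω] {f : Ω → ℝ} {s b : ℝ}
    (hhalf : 1 / 2 ≤ 𝔼 ω, if f ω = 0 then (1 : ℝ) else 0)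
    (hexp : 𝔼 ω, Real.exp (s * f ω) ≤ Real.exp (s * (𝔼 ω, f ω) + b)) :
    Real.cosh (s * 𝔼 ω, f ω) ≤ Real.exp b := by
  set m := 𝔼 ω, f ω with hm
  set p := 𝔼 ω, if f ω = 0 then (1 : ℝ) else 0 with hp
  set y := s * m with hy
  have hneg : Real.exp (-y) * Real.exp y = 1 := by rw [← Real.exp_add]; simp
  have hcoef : 0 ≤ Real.exp (-y) - Real.exp y * (1 - 2 * y) := by
    have h1 := Real.add_one_le_exp (-(2 * y))
    have h2 : Real.exp (-y) = Real.exp y * Real.exp (-(2 * y)) := by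
      rw [← Real.exp_add]; ring_nf
    rw [h2, ← mul_sub]
    exact mul_nonneg (Real.exp_pos _).le (by linarith)
  -- Exact where f = 0; elsewhere exp is replaced by its tangent at the extremal value s f = 2y.
  have hpt : ∀ ω, Real.exp y * (1 - 2 * y) + Real.exp y * s * f ω +
      (Real.exp (-y) - Real.exp y * (1 - 2 * y)) * (if f ω = 0 then (1 : ℝ) else 0) ≤
      Real.exp (-y) * Real.exp (s * f ω) := by
    intro ω
    split_ifs with h
    · rw [h]; simp
    · have h1 := Real.add_one_le_exp (s * f ω - 2 * y)
      have h2 : Real.exp (-y) * Real.exp (s * f ω) = Real.exp y * Real.exp (s * f ω - 2 * y) := by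
        rw [← Real.exp_add, ← Real.exp_add]; ring_nf
      rw [h2]
      have := mul_le_mul_of_nonneg_left h1 (Real.exp_pos y).le
      linarith
  have h1 := expect_le_expect fun ω (_ : ω ∈ Finset.univ) => hpt ω
  simp only [expect_add_distrib, ← mul_expect, Fintype.expect_const, ← hm, ← hp] at h1
  have h2 : Real.exp (-y) * 𝔼 ω, Real.exp (s * f ω) ≤ Real.exp b := by
    have := mul_le_mul_of_nonneg_left hexp (Real.exp_pos (-y)).le
    rwa [← Real.exp_add (-y), neg_add_cancel_left] at this
  have h3 := mul_le_mul_of_nonneg_left hhalf hcoef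
  rw [Real.cosh_eq]
  have h4 : Real.exp y * s * m = Real.exp y * y := by rw [hy]; ring
  linarith

theorem one_add_sq_div_two_le_cosh {x : ℝ} (hx : 0 ≤ x) : 1 + x ^ 2 / 2 ≤ Real.cosh x := by
  have h1 : Real.cosh x = 1 + 2 * Real.sinh (x / 2) ^ 2 := by
    have h := Real.cosh_two_mul (x / 2)
    rw [mul_div_cancel₀ _ two_ne_zero, Real.cosh_sq] at h
    linarith
  have h2 : x / 2 ≤ Real.sinh (x / 2) := Real.self_le_sinh_iff.2 (by positivity)
  nlinarith

/-- A nonnegative function that vanishes with probability at least `1 / 2` and satisfies the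
entropy bound with constant `c` has Gaussian tails around `0`. -/
theorem expect_tail_le {Ω : Type*} [Fintype Ω] [Nonempty Ω] {f : Ω → ℝ} {c : ℝ} (hc : 0 < c)
    (hf : ∀ ω, 0 ≤ f ω) (hhalf : 1 / 2 ≤ 𝔼 ω, if f ω = 0 then (1 : ℝ) else 0)
    (hent : ∀ s : ℝ, 0 < s → uniformEntropy (fun ω => Real.exp (s * f ω)) ≤
      c * s ^ 2 * 𝔼 ω, Real.exp (s * f ω)) {t : ℝ} (ht : 0 ≤ t) :
    (𝔼 ω, if t ≤ f ω then (1 : ℝ) else 0) ≤ Real.exp 1 * Real.exp (-(t ^ 2 / (8 * c))) := by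
  set m := 𝔼 ω, f ω with hm
  have hm0 : 0 ≤ m := Finset.expect_nonneg fun ω _ => hf ω
  -- Taking s = 1/√c gives 1 + m²/(2c) ≤ cosh(m/√c) ≤ e < 3.
  have hm4 : m ^ 2 ≤ 4 * c := by
    have hs : 0 < 1 / √c := by positivity
    have hsq : (1 / √c) ^ 2 = 1 / c := by rw [div_pow, one_pow, Real.sq_sqrt hc.le]
    have h1 := cosh_le_exp_of_expect_exp_le hhalf (expect_exp_le_of_uniformEntropy_le hent hs)
    rw [hsq, mul_one_div_cancel hc.ne', ← hm] at h1
    have h2 : 1 + (1 / √c * m) ^ 2 / 2 ≤ Real.cosh (1 / √c * m) := one_add_sq_div_two_le_cosh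
      (by positivity)
    rw [mul_pow, hsq] at h2
    have h3 := Real.exp_one_lt_d9
    have h4 : 1 / c * m ^ 2 ≤ 4 := by linarith
    rw [one_div, ← div_eq_inv_mul, div_le_iff₀ hc] at h4
    exact h4
  rw [← Real.exp_add]
  rcases le_or_gt t m with htm | htm
  · have h1 : t ^ 2 / (8 * c) ≤ 1 := by
      rw [div_le_one (by positivity)]; nlinarith
    calc _ ≤ 𝔼 _ω : Ω, (1 : ℝ) := expect_le_expect fun ω _ => by split_ifs <;> norm_num
      _ = 1 := Fintype.expect_const _
      _ ≤ _ := Real.one_le_exp (by linarith)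
  -- Chernoff's bound with the minimiser of -s(t - m) + c s².
  · set s := (t - m) / (2 * c) with hs
    have hspos : 0 < s := div_pos (by linarith) (by positivity)
    have h1 : (𝔼 ω, if t ≤ f ω then (1 : ℝ) else 0) ≤
        𝔼 ω, Real.exp (-(s * t)) * Real.exp (s * f ω) := by
      refine expect_le_expect fun ω _ => ?_
      rw [← Real.exp_add]
      split_ifs with h
      · exact Real.one_le_exp (by nlinarith)
      · exact (Real.exp_pos _).le
    rw [← mul_expect] at h1
    have h2 := mul_le_mul_of_nonneg_left (expect_exp_le_of_uniformEntropy_le hent hspos)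
      (Real.exp_pos (-(s * t))).le
    refine (h1.trans h2).trans ?_
    rw [← Real.exp_add, Real.exp_le_exp, ← hm]
    have h3 : -(s * t) + (s * m + c * s ^ 2) = -((t - m) ^ 2 / (4 * c)) := by
      rw [hs]; field_simp; ring
    -- From t² ≤ 2(t - m)² + 2m², which is (t - 2m)² ≥ 0, together with m² ≤ 4c.
    have h4 : t ^ 2 / (8 * c) ≤ (t - m) ^ 2 / (4 * c) + 1 := by
      rw [div_add_one (by positivity), div_le_div_iff₀ (by positivity) (by positivity)]
      nlinarith [sq_nonneg (t - 2 * m)]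
    rw [h3]
    linarith

/-- Since 1 - exp(-r) ≤ r, the form is charged to the endpoint with the larger exponent. Only
decreases of the function, seen from that endpoint, have to be controlled. -/
theorem logDirichlet_exp_le (a b : ℝ) : logDirichlet (Real.exp a) (Real.exp b) ≤
    max (a - b) 0 ^ 2 * Real.exp a + max (b - a) 0 ^ 2 * Real.exp b := by
  have key : ∀ a b : ℝ, b ≤ a → (Real.exp a - Real.exp b) * (a - b) ≤
      max (a - b) 0 ^ 2 * Real.exp a + max (b - a) 0 ^ 2 * Real.exp b := by
    intro a b h
    rw [max_eq_left (by linarith), max_eq_right (by linarith)]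
    have h1 := Real.add_one_le_exp (b - a)
    have h2 : Real.exp b = Real.exp a * Real.exp (b - a) := by rw [← Real.exp_add]; ring_nf
    have h3 : Real.exp a - Real.exp b ≤ Real.exp a * (a - b) := by
      rw [h2]
      nlinarith [mul_le_mul_of_nonneg_left h1 (Real.exp_pos a).le]
    nlinarith [mul_le_mul_of_nonneg_right h3 (sub_nonneg.2 h)]
  unfold logDirichlet
  rw [Real.log_exp, Real.log_exp]
  rcases le_total b a with h | h
  · exact key a b h
  · have := key b a h
    linarith

/-- A function on permutations whose positive discrete gradient is bounded satisfies the entropy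
bound of Herbst's argument. -/
theorem uniformEntropy_exp_le {n : ℕ} {f : Equiv.Perm (Fin n) → ℝ} {v : ℝ}
    (hgrad : ∀ σ, ∑ i, ∑ j, max (f σ - f (σ * Equiv.swap i j)) 0 ^ 2 ≤ v) {s : ℝ} (hs : 0 < s) :
    uniformEntropy (fun σ => Real.exp (s * f σ)) ≤
      v / n * s ^ 2 * 𝔼 σ, Real.exp (s * f σ) := by
  have hswap : ∀ i j, swapForm (fun σ => Real.exp (s * f σ)) i j ≤
      2 * 𝔼 σ, s ^ 2 * max (f σ - f (σ * Equiv.swap i j)) 0 ^ 2 * Real.exp (s * f σ) := by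
    intro i j
    have hmax : ∀ a b, max (s * a - s * b) 0 ^ 2 = s ^ 2 * max (a - b) 0 ^ 2 := by
      intro a b
      rw [← mul_sub, ← mul_pow, mul_max_of_nonneg _ _ hs.le, mul_zero]
    -- Substituting σ * (i j) for σ identifies the two one-sided terms; the resulting 2 cancels the
    -- one in 1/(2n).
    have hinvol : 𝔼 σ, s ^ 2 * max (f (σ * Equiv.swap i j) - f σ) 0 ^ 2 *
        Real.exp (s * f (σ * Equiv.swap i j)) =
        𝔼 σ, s ^ 2 * max (f σ - f (σ * Equiv.swap i j)) 0 ^ 2 * Real.exp (s * f σ) := by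
      rw [← expect_comp_equiv (Equiv.mulRight (Equiv.swap i j))
        fun σ => s ^ 2 * max (f σ - f (σ * Equiv.swap i j)) 0 ^ 2 * Real.exp (s * f σ)]
      simp [mul_assoc]
    calc _ ≤ 𝔼 σ, (s ^ 2 * max (f σ - f (σ * Equiv.swap i j)) 0 ^ 2 * Real.exp (s * f σ) +
          s ^ 2 * max (f (σ * Equiv.swap i j) - f σ) 0 ^ 2 *
            Real.exp (s * f (σ * Equiv.swap i j))) := by
          refine expect_le_expect fun σ _ => (logDirichlet_exp_le _ _).trans_eq ?_
          rw [hmax, hmax]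
      _ = _ := by rw [expect_add_distrib, hinvol, two_mul]
  refine (uniformEntropy_perm_le fun σ => Real.exp_pos _).trans ?_
  have h1 : ∑ i, ∑ j, swapForm (fun σ => Real.exp (s * f σ)) i j ≤
      2 * (v * s ^ 2 * 𝔼 σ, Real.exp (s * f σ)) := by
    calc _ ≤ ∑ i, ∑ j, 2 * 𝔼 σ, s ^ 2 * max (f σ - f (σ * Equiv.swap i j)) 0 ^ 2 *
          Real.exp (s * f σ) :=
          Finset.sum_le_sum fun i _ => Finset.sum_le_sum fun j _ => hswap i j
      _ = 2 * 𝔼 σ, ∑ i, ∑ j, s ^ 2 * max (f σ - f (σ * Equiv.swap i j)) 0 ^ 2 *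
          Real.exp (s * f σ) := by
          simp only [← Finset.mul_sum, Finset.expect_sum_comm]
      _ ≤ 2 * 𝔼 σ, v * s ^ 2 * Real.exp (s * f σ) := by
          refine mul_le_mul_of_nonneg_left (expect_le_expect fun σ _ => ?_) (by norm_num)
          simp only [← Finset.sum_mul, ← Finset.mul_sum]
          refine mul_le_mul_of_nonneg_right ?_ (Real.exp_pos _).le
          rw [mul_comm v]
          exact mul_le_mul_of_nonneg_left (hgrad σ) (sq_nonneg s)
      _ = _ := by rw [← mul_expect]
  calc _ ≤ 1 / (2 * (n : ℝ)) * (2 * (v * s ^ 2 * 𝔼 σ, Real.exp (s * f σ))) :=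
        mul_le_mul_of_nonneg_left h1 (by positivity)
    _ = _ := by
      rw [one_div, mul_inv]; ring

end Concentration

/-! ### The convex distance and its gradient along transpositions. -/

section ConvexDistance

variable {n : ℕ}

theorem weightedHamming_nonneg (α : EuclideanSpace ℝ (Fin n)) (ω ω' : Fin n → ℝ) :
    0 ≤ weightedHamming α ω ω' :=
  Finset.sum_nonneg fun i _ => by split_ifs <;> positivity

theorem weightedHamming_self (α : EuclideanSpace ℝ (Fin n)) (ω : Fin n → ℝ) :
    weightedHamming α ω ω = 0 := by simp [weightedHamming]

theorem bddBelow_weightedHamming (α : EuclideanSpace ℝ (Fin n)) (ω : Fin n → ℝ)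
    (A : Set (Fin n → ℝ)) : BddBelow (Set.range fun ω' : A => weightedHamming α ω ω'.1) :=
  ⟨0, by rintro _ ⟨ω', rfl⟩; exact weightedHamming_nonneg _ _ _⟩

theorem convexDistance_nonneg (ω : Fin n → ℝ) (A : Set (Fin n → ℝ)) : 0 ≤ convexDistance ω A :=
  Real.iSup_nonneg fun _ => Real.iInf_nonneg fun _ => weightedHamming_nonneg _ _ _

theorem convexDistance_eq_zero {ω : Fin n → ℝ} {A : Set (Fin n → ℝ)} (h : ω ∈ A) :
    convexDistance ω A = 0 := by
  refine le_antisymm (Real.iSup_le (fun α => ?_) le_rfl) (convexDistance_nonneg ω A)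
  exact (ciInf_le (bddBelow_weightedHamming α.1 ω A) ⟨ω, h⟩).trans_eq (weightedHamming_self _ _)

/-- The supremum in the convex distance is attained. -/
theorem exists_convexDistance_eq (hn : 1 ≤ n) (ω : Fin n → ℝ) (A : Set (Fin n → ℝ)) :
    ∃ α : Metric.sphere (0 : EuclideanSpace ℝ (Fin n)) 1,
      convexDistance ω A = (⨅ ω' : A, weightedHamming α.1 ω ω'.1) ∧
      ∀ β : Metric.sphere (0 : EuclideanSpace ℝ (Fin n)) 1,
        (⨅ ω' : A, weightedHamming β.1 ω ω'.1) ≤ convexDistance ω A := by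
  have : Nonempty (Fin n) := ⟨⟨0, hn⟩⟩
  have hcont : ∀ ω' : A, Continuous fun α : Metric.sphere (0 : EuclideanSpace ℝ (Fin n)) 1 =>
      weightedHamming α.1 ω ω'.1 := by
    intro ω'
    unfold weightedHamming
    refine continuous_finsetSum _ fun i _ => ?_
    split_ifs <;> fun_prop
  -- An infimum of continuous functions is upper semicontinuous, hence attains its maximum on the
  -- compact sphere.
  have husc : UpperSemicontinuous fun α : Metric.sphere (0 : EuclideanSpace ℝ (Fin n)) 1 =>
      ⨅ ω' : A, weightedHamming α.1 ω ω'.1 :=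
    upperSemicontinuous_ciInf (fun α => bddBelow_weightedHamming α.1 ω A)
      fun ω' => (hcont ω').upperSemicontinuous
  have : Nonempty (Metric.sphere (0 : EuclideanSpace ℝ (Fin n)) 1) :=
    (NormedSpace.sphere_nonempty.2 zero_le_one).to_subtype
  obtain ⟨α, -, hα⟩ := UpperSemicontinuousOn.exists_isMaxOn Set.univ_nonempty isCompact_univ
    (husc.upperSemicontinuousOn Set.univ)
  have hmax : ∀ β : Metric.sphere (0 : EuclideanSpace ℝ (Fin n)) 1,
      (⨅ ω' : A, weightedHamming β.1 ω ω'.1) ≤ ⨅ ω' : A, weightedHamming α.1 ω ω'.1 :=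
    fun β => hα (Set.mem_univ β)
  have heq : convexDistance ω A = ⨅ ω' : A, weightedHamming α.1 ω ω'.1 :=
    le_antisymm (ciSup_le hmax) (le_ciSup (f := fun β :
      Metric.sphere (0 : EuclideanSpace ℝ (Fin n)) 1 => ⨅ ω' : A, weightedHamming β.1 ω ω'.1)
      ⟨_, by rintro _ ⟨β, rfl⟩; exact hmax β⟩ α)
  exact ⟨α, heq, fun β => heq ▸ hmax β⟩

/-- An optimal weight vector for ω, permuted by σ, competes for `ω ∘ σ`; symmetry allows the points
of `A` to be permuted along with it. -/
theorem convexDistance_le_comp_perm (hn : 1 ≤ n) {A : Set (Fin n → ℝ)} (hA : A.Nonempty)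
    (hsymm : IsSymmetricSet A) (ω : Fin n → ℝ) (σ : Equiv.Perm (Fin n)) :
    convexDistance ω A ≤ convexDistance (ω ∘ σ) A := by
  have : Nonempty A := hA.to_subtype
  obtain ⟨α, hα, -⟩ := exists_convexDistance_eq hn ω A
  obtain ⟨-, -, hle⟩ := exists_convexDistance_eq hn (ω ∘ σ) A
  let β : EuclideanSpace ℝ (Fin n) := WithLp.toLp 2 fun i => α.1 (σ i)
  have hβ : β ∈ Metric.sphere (0 : EuclideanSpace ℝ (Fin n)) 1 := by
    have h := α.2
    rw [mem_sphere_zero_iff_norm, EuclideanSpace.norm_eq] at h ⊢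
    rw [← h]
    congr 1
    exact Equiv.sum_comp σ fun i => ‖α.1 i‖ ^ 2
  refine le_trans ?_ (hle ⟨β, hβ⟩)
  rw [hα]
  refine le_ciInf fun ω' => ?_
  have hmem : (fun i => ω'.1 (σ.symm i)) ∈ A := hsymm σ.symm ω'.1 ω'.2
  refine (ciInf_le (bddBelow_weightedHamming α.1 ω A) ⟨_, hmem⟩).trans_eq ?_
  unfold weightedHamming
  rw [← Equiv.sum_comp σ]
  simp [β]

theorem convexDistance_comp_perm (hn : 1 ≤ n) {A : Set (Fin n → ℝ)} (hA : A.Nonempty)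
    (hsymm : IsSymmetricSet A) (ω : Fin n → ℝ) (σ : Equiv.Perm (Fin n)) :
    convexDistance (ω ∘ σ) A = convexDistance ω A := by
  refine le_antisymm ?_ (convexDistance_le_comp_perm hn hA hsymm ω σ)
  have := convexDistance_le_comp_perm hn hA hsymm (ω ∘ σ) σ.symm
  rwa [Function.comp_assoc, Equiv.self_comp_symm, Function.comp_id] at this

theorem weightedHamming_le_add_abs (α : EuclideanSpace ℝ (Fin n)) {ω η : Fin n → ℝ} {i : Fin n}
    (h : ∀ k, k ≠ i → ω k = η k) (ω' : Fin n → ℝ) :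
    weightedHamming α ω ω' ≤ weightedHamming α η ω' + |α i| := by
  unfold weightedHamming
  have : |α i| = ∑ k, if k = i then |α k| else 0 := by simp
  rw [this, ← Finset.sum_add_distrib]
  refine Finset.sum_le_sum fun k _ => ?_
  by_cases hk : k = i
  · simp only [hk, if_true]
    split_ifs <;> simp
  · simp [hk, h k hk]

/-- Resampling one coordinate lowers the convex distance by at most the weight of the coordinate
in an optimal weight vector. -/
theorem exists_weights_convexDistance_le (hn : 1 ≤ n) (ω : Fin n → ℝ) {A : Set (Fin n → ℝ)}
    (hA : A.Nonempty) : ∃ α : EuclideanSpace ℝ (Fin n), ∑ i, |α i| ^ 2 = 1 ∧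
      ∀ (i : Fin n) (η : Fin n → ℝ), (∀ k, k ≠ i → ω k = η k) →
        convexDistance ω A ≤ convexDistance η A + |α i| := by
  have : Nonempty A := hA.to_subtype
  obtain ⟨α, hα, -⟩ := exists_convexDistance_eq hn ω A
  refine ⟨α.1, ?_, fun i η h => ?_⟩
  · have h := α.2
    rw [mem_sphere_zero_iff_norm, EuclideanSpace.norm_eq, Real.sqrt_eq_one] at h
    simpa using h
  · obtain ⟨-, -, hle⟩ := exists_convexDistance_eq hn η A
    rw [hα, ← sub_le_iff_le_add]
    -- The weights optimal for ω are merely a competitor for η.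
    refine le_trans ?_ (hle α)
    refine le_ciInf fun ω' => ?_
    rw [sub_le_iff_le_add]
    exact (ciInf_le (bddBelow_weightedHamming α.1 ω A) ω').trans
      (weightedHamming_le_add_abs α.1 h ω'.1)

/-- The convex distance to a symmetric set as a function on arrangements: its gradient along
transpositions only sees the exchanges between the sample and its complement. -/
theorem sum_sq_gradient_convexDistance_le {N : ℕ} (hn : 1 ≤ n) (hnN : n ≤ N)
    {A : Set (Fin n → ℝ)} (hA : A.Nonempty) (hsymm : IsSymmetricSet A) (ω : Fin N → ℝ) :
    ∑ i, ∑ j, max (convexDistance (firstCoords hnN ω) A -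
      convexDistance (firstCoords hnN (ω ∘ Equiv.swap i j)) A) 0 ^ 2 ≤ 2 * ((N : ℝ) - n) := by
  obtain ⟨α, hα, hgrad⟩ := exists_weights_convexDistance_le hn (firstCoords hnN ω) hA
  -- Squared optimal weights on the sample (total 1) and the indicator of its complement (total N -
  -- n). The gradient is dominated by c_i o_j + o_i c_j.
  set c : Fin N → ℝ := fun i => if h : (i : ℕ) < n then |α ⟨i, h⟩| ^ 2 else 0 with hc
  set o : Fin N → ℝ := fun i => if (i : ℕ) < n then 0 else 1 with ho
  have hcnn : ∀ i, 0 ≤ c i := fun i => by simp only [hc]; split_ifs <;> positivity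
  have honn : ∀ i, 0 ≤ o i := fun i => by simp only [ho]; split_ifs <;> norm_num
  have one : ∀ i j : Fin N, (i : ℕ) < n → max (convexDistance (firstCoords hnN ω) A -
      convexDistance (firstCoords hnN (ω ∘ Equiv.swap i j)) A) 0 ^ 2 ≤ c i * o j := by
    intro i j hi
    -- An exchange inside the sample leaves the distance unchanged by symmetry; otherwise only the
    -- sampled coordinate i is altered.
    by_cases hj : (j : ℕ) < n
    · have : firstCoords hnN (ω ∘ Equiv.swap i j) =
          firstCoords hnN ω ∘ Equiv.swap ⟨i, hi⟩ ⟨j, hj⟩ := by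
        funext k
        have h := (Fin.castLE_injective hnN).map_swap (x := ⟨i, hi⟩) (y := ⟨j, hj⟩) (z := k)
        simp only [firstCoords, Function.comp_apply, h]
        rfl
      rw [this, convexDistance_comp_perm hn hA hsymm]
      simpa using mul_nonneg (hcnn i) (honn j)
    · have h := hgrad ⟨i, hi⟩ (firstCoords hnN (ω ∘ Equiv.swap i j)) fun k hk => by
        have h1 : Fin.castLE hnN k ≠ i := fun h => hk (by ext; simp [← h])
        have h2 : Fin.castLE hnN k ≠ j := fun h => hj (by simp [← h])
        simp [firstCoords, Equiv.swap_apply_of_ne_of_ne h1 h2]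
      simp only [hc, ho, hi, hj, dif_pos, if_false, mul_one]
      exact pow_le_pow_left₀ (le_max_right _ _) (max_le (by linarith) (abs_nonneg _)) 2
  have bound : ∀ i j : Fin N, max (convexDistance (firstCoords hnN ω) A -
      convexDistance (firstCoords hnN (ω ∘ Equiv.swap i j)) A) 0 ^ 2 ≤ c i * o j + o i * c j := by
    intro i j
    have hij := mul_nonneg (hcnn i) (honn j)
    have hji := mul_nonneg (honn i) (hcnn j)
    by_cases hi : (i : ℕ) < n
    · linarith [one i j hi]
    by_cases hj : (j : ℕ) < n
    · have := one j i hj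
      rw [Equiv.swap_comm] at this
      linarith
    · have : firstCoords hnN (ω ∘ Equiv.swap i j) = firstCoords hnN ω := by
        funext k
        have h1 : Fin.castLE hnN k ≠ i := fun h => hi (by simp [← h])
        have h2 : Fin.castLE hnN k ≠ j := fun h => hj (by simp [← h])
        simp [firstCoords, Equiv.swap_apply_of_ne_of_ne h1 h2]
      rw [this]
      simpa using add_nonneg hij hji
  obtain ⟨m, rfl⟩ := Nat.exists_eq_add_of_le hnN
  have hcsum : ∑ i, c i = 1 := by
    rw [Fin.sum_univ_add]
    simpa [hc] using hα
  have hosum : ∑ i, o i = m := by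
    rw [Fin.sum_univ_add]
    simp [ho]
  calc _ ≤ ∑ i, ∑ j, (c i * o j + o i * c j) :=
        Finset.sum_le_sum fun i _ => Finset.sum_le_sum fun j _ => bound i j
    _ = _ := by
      simp only [Finset.sum_add_distrib, ← Finset.mul_sum, ← Finset.sum_mul, hcsum, hosum]
      push_cast
      ring

end ConvexDistance

/-! ### Sampling without replacement as a uniform random permutation. -/

section SamplingWithoutReplacement

open scoped BigOperators

theorem finite_multislice {L N : ℕ} (κ : Fin L → ℕ) (x : Fin L → ℝ) :
    (multislice (N := N) κ x).Finite :=
  (Set.Finite.pi' fun _ => Set.finite_range x).subset fun _ hω => hω.1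

theorem comp_perm_mem_multislice {L N : ℕ} {κ : Fin L → ℕ} {x : Fin L → ℝ} {ω : Fin N → ℝ}
    (hω : ω ∈ multislice κ x) (σ : Equiv.Perm (Fin N)) : ω ∘ σ ∈ multislice κ x := by
  refine ⟨fun i => hω.1 (σ i), fun l => ?_⟩
  rw [← hω.2 l]
  exact Finset.card_equiv σ (by simp)

/-- Permutations act transitively on the multislice. -/
theorem exists_perm_of_mem_multislice {L N : ℕ} {κ : Fin L → ℕ} {x : Fin L → ℝ}
    {ω η : Fin N → ℝ} (hω : ω ∈ multislice κ x) (hη : η ∈ multislice κ x) :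
    ∃ σ : Equiv.Perm (Fin N), ω ∘ σ = η := by
  -- The level sets of ω and η have equal sizes, so bijections between them glue to a permutation.
  have hcard : ∀ y, Fintype.card {i // η i = y} = Fintype.card {i // ω i = y} := by
    intro y
    by_cases hy : y ∈ Set.range x
    · obtain ⟨l, rfl⟩ := hy
      rw [Fintype.card_subtype, Fintype.card_subtype, hω.2 l, hη.2 l]
    · have h1 : IsEmpty {i // η i = y} := ⟨fun i => hy (i.2 ▸ hη.1 i.1)⟩
      have h2 : IsEmpty {i // ω i = y} := ⟨fun i => hy (i.2 ▸ hω.1 i.1)⟩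
      simp
  let e : ∀ y, {i // η i = y} ≃ {i // ω i = y} := fun y => Fintype.equivOfCardEq (hcard y)
  exact ⟨Equiv.ofFiberEquiv e, funext fun i => Equiv.ofFiberEquiv_map e i⟩

open Classical in
/-- The uniform distribution on the multislice is the law of a randomly permuted arrangement. -/
theorem uniformOn_multislice_real {L N : ℕ} {κ : Fin L → ℕ} {x : Fin L → ℝ} {ω : Fin N → ℝ}
    (hω : ω ∈ multislice κ x) (B : Set (Fin N → ℝ)) :
    (ProbabilityTheory.uniformOn (multislice (N := N) κ x)).real B =
      𝔼 σ : Equiv.Perm (Fin N), if ω ∘ σ ∈ B then (1 : ℝ) else 0 := by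
  set M := (finite_multislice (N := N) κ x).toFinset with hM
  have hMset : multislice (N := N) κ x = (M : Set (Fin N → ℝ)) := by simp [hM]
  have hmem : ∀ η, η ∈ M ↔ η ∈ multislice κ x := by simp [hM]
  set k := (Finset.univ.filter fun σ : Equiv.Perm (Fin N) => ω ∘ σ = ω).card with hk
  -- The fibres of σ ↦ `ω ∘ σ` are cosets of the stabiliser of ω, so counting permutations is
  -- counting arrangements `k` times.
  have hfib : ∀ η ∈ M, (Finset.univ.filter fun σ : Equiv.Perm (Fin N) => ω ∘ σ = η).card = k := by
    intro η hη
    obtain ⟨τ, hτ⟩ := exists_perm_of_mem_multislice hω ((hmem η).1 hη)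
    refine (Finset.card_equiv (Equiv.mulRight τ) fun σ => ?_).symm
    simp only [Finset.mem_filter, Finset.mem_univ, true_and, Equiv.coe_mulRight,
      Equiv.Perm.coe_mul, ← Function.comp_assoc]
    rw [← hτ, τ.surjective.injective_comp_right.eq_iff]
  have hcount : ∀ (P : (Fin N → ℝ) → Prop) [DecidablePred P],
      (Finset.univ.filter fun σ : Equiv.Perm (Fin N) => P (ω ∘ σ)).card =
        (M.filter P).card * k := by
    intro P _
    rw [Finset.card_eq_sum_card_fiberwise (f := fun σ : Equiv.Perm (Fin N) => ω ∘ σ)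
      (t := M.filter P)]
    · rw [Finset.sum_const_nat (m := k)]
      intro η hη
      rw [Finset.mem_filter] at hη
      rw [← hfib η hη.1, Finset.filter_filter]
      congr 1
      ext σ
      simp only [Finset.mem_filter, Finset.mem_univ, true_and, and_iff_right_iff_imp]
      rintro rfl
      exact hη.2
    · intro σ hσ
      simp only [Finset.coe_filter, Set.mem_ofPred_eq, Finset.mem_univ, true_and] at hσ ⊢
      exact ⟨(hmem _).2 (comp_perm_mem_multislice hω σ), hσ⟩
  have htotal : (Fintype.card (Equiv.Perm (Fin N)) : ℝ) = M.card * k := by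
    have := hcount fun η => η ∈ M
    have h1 : (Finset.univ.filter fun σ : Equiv.Perm (Fin N) => ω ∘ σ ∈ M) = Finset.univ :=
      Finset.filter_true_of_mem fun σ _ => (hmem _).2 (comp_perm_mem_multislice hω σ)
    rw [h1, Finset.filter_true_of_mem fun _ h => h, Finset.card_univ] at this
    exact_mod_cast this
  have hkpos : (k : ℝ) ≠ 0 := by
    have : 0 < k := Finset.card_pos.2 ⟨1, Finset.mem_filter.2 ⟨Finset.mem_univ _, rfl⟩⟩
    exact Nat.cast_ne_zero.2 this.ne'
  rw [Fintype.expect_eq_sum_div_card, Finset.sum_boole, hcount fun η => η ∈ B, htotal,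
    Nat.cast_mul, mul_div_mul_right _ _ hkpos, MeasureTheory.measureReal_def,
    ProbabilityTheory.uniformOn, ProbabilityTheory.cond_apply
      (finite_multislice κ x).measurableSet, hMset]
  have : (M : Set (Fin N → ℝ)) ∩ B = (M.filter fun η => η ∈ B : Finset (Fin N → ℝ)) := by
    ext; simp
  rw [this, MeasureTheory.Measure.count_apply_finset, MeasureTheory.Measure.count_apply_finset]
  simp [div_eq_inv_mul]

theorem finite_sampleSpace {L n N : ℕ} (κ : Fin L → ℕ) (x : Fin L → ℝ) (h : n ≤ N) :
    (sampleSpace κ x h).Finite := (finite_multislice κ x).image _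

open Classical in
theorem sampleLaw_real {L n N : ℕ} {κ : Fin L → ℕ} {x : Fin L → ℝ} (h : n ≤ N) {ω : Fin N → ℝ}
    (hω : ω ∈ multislice κ x) {B : Set (Fin n → ℝ)} (hB : B ⊆ sampleSpace κ x h) :
    (sampleLaw κ x h).real B =
      𝔼 σ : Equiv.Perm (Fin N), if firstCoords h (ω ∘ σ) ∈ B then (1 : ℝ) else 0 := by
  have hmeas : Measurable (firstCoords (n := n) (N := N) h) :=
    measurable_pi_lambda _ fun i => measurable_pi_apply _
  rw [sampleLaw, MeasureTheory.map_measureReal_apply hmeas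
    ((finite_sampleSpace κ x h).subset hB).measurableSet, uniformOn_multislice_real hω]
  rfl

/-- When the whole population is sampled, a nonempty symmetric set contains every sample. -/
theorem sampleSpace_subset_of_symmetric {L n : ℕ} {κ : Fin L → ℕ} {x : Fin L → ℝ} (h : n ≤ n)
    {A : Set (Fin n → ℝ)} (hA : A ⊆ sampleSpace κ x h) (hne : A.Nonempty)
    (hsymm : IsSymmetricSet A) : sampleSpace κ x h ⊆ A := by
  rintro _ ⟨η, hη, rfl⟩
  obtain ⟨a, ha⟩ := hne
  obtain ⟨ω, hω, rfl⟩ := hA ha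
  obtain ⟨σ, rfl⟩ := exists_perm_of_mem_multislice hω hη
  exact hsymm σ _ ha

end SamplingWithoutReplacement

/-! ### The convex distance inequality. -/

/-- Convex distance inequality for `n` out of `N` sampling without replacement. For `n < N` the
bound is `e · exp (-t² / (16 (1 - n / N)))`; for `n = N` this bound is to be read as its limit,
which is `0` for `t > 0`. -/
theorem theorem1p8 {L n N : ℕ} (hL : 2 ≤ L) (κ : Fin L → ℕ) (hκ : ∀ l, 1 ≤ κ l)
    (hN : ∑ l, κ l = N) (x : Fin L → ℝ) (hx : Function.Injective x)
    (hn : 1 ≤ n) (hnN : n ≤ N)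
    (A : Set (Fin n → ℝ)) (hA : A ⊆ sampleSpace κ x hnN) (hsymm : IsSymmetricSet A)
    (hhalf : 1 / 2 ≤ (sampleLaw κ x hnN).real A) (t : ℝ) (ht : 0 ≤ t) :
    (n < N →
      (sampleLaw κ x hnN).real {ω ∈ sampleSpace κ x hnN | t ≤ convexDistance ω A} ≤
        Real.exp 1 * Real.exp (-(t ^ 2 / (16 * (1 - (n : ℝ) / (N : ℝ)))))) ∧
    (n = N → 0 < t →
      (sampleLaw κ x hnN).real {ω ∈ sampleSpace κ x hnN | t ≤ convexDistance ω A} = 0) := by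
  classical
  have hAne : A.Nonempty := by
    rw [Set.nonempty_iff_ne_empty]
    rintro rfl
    norm_num at hhalf
  obtain ⟨ω, hω⟩ : (multislice (N := N) κ x).Nonempty := by
    obtain ⟨a, ha⟩ := hAne
    obtain ⟨ω, hω, -⟩ := hA ha
    exact ⟨ω, hω⟩
  constructor
  · intro hlt
    have hN0 : (0 : ℝ) < N := by exact_mod_cast hn.trans hnN
    have hltR : (n : ℝ) < N := by exact_mod_cast hlt
    set f : Equiv.Perm (Fin N) → ℝ :=
      fun σ => convexDistance (firstCoords hnN (ω ∘ σ)) A with hf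
    -- The entropy constant: gradient bound 2(N - n) divided by N.
    have hc : 0 < 2 * ((N : ℝ) - n) / N := div_pos (by linarith) hN0
    have hzero : 1 / 2 ≤ Finset.expect Finset.univ
        fun σ => if f σ = 0 then (1 : ℝ) else 0 := by
      refine hhalf.trans ?_
      rw [sampleLaw_real hnN hω hA]
      refine Finset.expect_le_expect fun σ _ => ?_
      by_cases h : firstCoords hnN (ω ∘ σ) ∈ A
      · rw [if_pos h, if_pos (convexDistance_eq_zero h)]
      · rw [if_neg h]
        split_ifs <;> norm_num
    have htail := expect_tail_le hc (fun σ => convexDistance_nonneg _ A) hzero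
      (fun s hs => uniformEntropy_exp_le (fun σ => by
        simpa only [hf, Equiv.Perm.coe_mul, Function.comp_assoc] using
          sum_sq_gradient_convexDistance_le hn hnN hAne hsymm (ω ∘ σ)) hs) ht
    have hconst : 8 * (2 * ((N : ℝ) - n) / N) = 16 * (1 - (n : ℝ) / N) := by
      field_simp
      ring
    rw [hconst] at htail
    rw [sampleLaw_real hnN hω (Set.sep_subset _ _)]
    refine le_trans (Finset.expect_le_expect fun σ _ => ?_) htail
    by_cases h : t ≤ f σ
    · rw [if_pos h]
      split_ifs <;> norm_num
    · rw [if_neg h, if_neg fun hmem => h hmem.2]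
  · rintro rfl htpos
    -- Here `A` is the whole sample space, so the distance vanishes on every sample.
    have hempty : {ω ∈ sampleSpace κ x hnN | t ≤ convexDistance ω A} = ∅ := by
      ext η
      simp only [Set.mem_ofPred_eq, Set.mem_empty_iff_false, iff_false, not_and, not_le]
      intro hη
      rwa [convexDistance_eq_zero (sampleSpace_subset_of_symmetric hnN hA hAne hsymm hη)]
    rw [hempty]
    simp
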